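/- Let $\phi_1,\dots,\phi_k:\mathbb{R}^n\to\mathbb{R}$ be basis functions, $b(z)=(\phi_1(z),\dots,\phi_k(z))^\top$, and for $\theta\in\mathbb{R}^{k\times m}$ let $\phi^\theta(z)=\theta^\top b(z)$. For a symmetric partitioned matrix $M=\begin{bmatrix}M_{11}&M_{12}\\M_{21}&M_{22}\end{bmatrix}$ with $M_{11}\in\mathbb{R}^{u\times u}$, $M_{22}\in\mathbb{R}^{v\times v}$, put $$\mathcal{Z}(M)=\Big\{Z\in\mathbb{R}^{v\times u}\;\Big|\;\begin{bmatrix}I_u\\Z\end{bmatrix}^\top M\begin{bmatrix}I_u\\Z\end{bmatrix}\ge 0\Big\},$$ where $\ge 0$ (resp. $>0$) means symmetric positive semidefinite (resp. definite). Let $\hat\theta\in\mathbb{R}^{k\times m}$, let $z_1,\dots,z_T\in\mathbb{R}^n$, and let $y_i=\phi^{\hat\theta}(z_i)+w_i$ with $w_i\in\mathbb{R}^m$, $i=1,\dots,T$. Put $Y=[y_1\ \cdots\ y_T]$, $W=[w_1\ \cdots\ w_T]$, $\Phi=[b(z_1)\ \cdots\ b(z_T)]$. Assume $W^\top\in\mathcal{Z}(\Pi)$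 for a symmetric matrix $\Pi\in\mathbb{R}^{(m+T)\times(m+T)}$ with $\Pi_{22}<0$ and $\Pi_{11}-\Pi_{12}\Pi_{22}^{-1}\Pi_{21}\ge 0$. Let $$N=\begin{bmatrix}I_m&Y\\0&-\Phi\end{bmatrix}\Pi\begin{bmatrix}I_m&Y\\0&-\Phi\end{bmatrix}^\top,\qquad \Theta=\mathcal{Z}(N)\subseteq\mathbb{R}^{k\times m},$$ and assume that $N$ has at least one positive eigenvalue. Let $P\in\mathbb{R}^{m\times m}$ and $Q\in\mathbb{R}^{n\times n}$ be symmetric positive definite, let $L\ge 0$, and write $\|x\|_{2,R}=\|Rx\|_2$. (1) For all $z,z^\star\in\mathbb{R}^n$ with $z\ne z^\star$: one has $$\|\phi^\theta(z)-\phi^\theta(z^\star)\|_{2,P^{1/2}}\le L\,\|z-z^\star\|_{2,Q^{1/2}}\quad\text{for all }\theta\in\Theta$$ if and only if there exists $\alpha\ge 0$ such that, with $d=\dfrac{b(z)-b(z^\star)}{\|z-z^\star\|_{2,Q^{1/2}}}$, $$\begin{bmatrix}L^2P^{-1}&0&0\\0&0&d\\0&d^\top&1\end{bmatrix}-\alpha\begin{bmatrix}N&0\\0&0\end{bmatrix}\ge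 0.$$ (2) If, in addition, the functions $\phi_i$ are differentiable, then for every $z\in\mathbb{R}^n$: one has $\|J(\phi^\theta)(z)\|_2\le L$ for all $\theta\in\Theta$ if and only if there exists $\alpha\ge 0$ such that $$\begin{bmatrix}L^2I_m&0&0\\0&0&J(b)(z)\\0&J(b)(z)^\top&I_n\end{bmatrix}-\alpha\begin{bmatrix}N&0\\0&0\end{bmatrix}\ge 0,$$ where $J(f)$ denotes the Jacobian matrix of $f$ and $\|\cdot\|_2$ is the matrix norm induced by the Euclidean norms. -/

import Mathlib

namespace SetValuedRegression

open Matrix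

/-- The column space `ℝⁿ` with the Euclidean norm. -/
abbrev Vec (n : ℕ) : Type := EuclideanSpace ℝ (Fin n)

/-- The Schur complement `M|M₂₂ = M₁₁ - M₁₂ M₂₂⁻¹ M₂₁` of a partitioned matrix. It is only used
for matrices with invertible `M₂₂`, where the pseudoinverse of `M₂₂` is its inverse. -/
noncomputable def schurCompl {u v : ℕ} (M : Matrix (Fin u ⊕ Fin v) (Fin u ⊕ Fin v) ℝ) :
    Matrix (Fin u) (Fin u) ℝ :=
  M.toBlocks₁₁ - M.toBlocks₁₂ * M.toBlocks₂₂⁻¹ * M.toBlocks₂₁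

/-- The solution set `𝒵(M) = {Z ∈ ℝ^{v×u} | [I; Z]ᵀ M [I; Z] ≥ 0}` of a quadratic matrix
inequality. -/
def qmiSet {u v : ℕ} (M : Matrix (Fin u ⊕ Fin v) (Fin u ⊕ Fin v) ℝ) :
    Set (Matrix (Fin v) (Fin u) ℝ) :=
  {Z | ((fromRows (1 : Matrix (Fin u) (Fin u) ℝ) Z)ᵀ * M *
    fromRows (1 : Matrix (Fin u) (Fin u) ℝ) Z).PosSemidef}

/-- The noise model: `Π` is symmetric, `Π₂₂ < 0` and `Π|Π₂₂ ≥ 0`. -/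
structure IsNoiseModel {m T : ℕ} (Pi : Matrix (Fin m ⊕ Fin T) (Fin m ⊕ Fin T) ℝ) : Prop where
  isSymm : Pi.IsSymm
  neg_def : (-Pi.toBlocks₂₂).PosDef
  schur_nonneg : (schurCompl Pi).PosSemidef

/-- The matrix whose columns are the given vectors. -/
def colMatrix {p T : ℕ} (x : Fin T → Vec p) : Matrix (Fin p) (Fin T) ℝ :=
  Matrix.of fun i t => x t i

/-- The vector of basis functions `b(z) = (φ₁(z), …, φ_k(z))`. -/
def basisVec {n k : ℕ} (φ : Fin k → Vec n → ℝ) (z : Vec n) : Vec k :=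
  WithLp.toLp 2 fun i => φ i z

/-- The linear combination `φ^θ(z) = θᵀ b(z)`. -/
def paramFun {n k m : ℕ} (φ : Fin k → Vec n → ℝ) (θ : Matrix (Fin k) (Fin m) ℝ) (z : Vec n) :
    Vec m :=
  WithLp.toLp 2 (θᵀ *ᵥ (basisVec φ z).ofLp)

/-- The data matrix `N = [I Y; 0 -Φ] Π [I Y; 0 -Φ]ᵀ`. -/
def dataMatrix {m k T : ℕ} (Pi : Matrix (Fin m ⊕ Fin T) (Fin m ⊕ Fin T) ℝ)
    (Y : Matrix (Fin m) (Fin T) ℝ) (Phi : Matrix (Fin k) (Fin T) ℝ) :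
    Matrix (Fin m ⊕ Fin k) (Fin m ⊕ Fin k) ℝ :=
  let D : Matrix (Fin m ⊕ Fin k) (Fin m ⊕ Fin T) ℝ :=
    fromBlocks (1 : Matrix (Fin m) (Fin m) ℝ) Y (0 : Matrix (Fin k) (Fin m) ℝ) (-Phi)
  D * Pi * Dᵀ

/-- `A` has at least one positive eigenvalue. -/
def HasPosEigenvalue {ι : Type*} [Fintype ι] [DecidableEq ι] (A : Matrix ι ι ℝ) : Prop :=
  ∃ μ : ℝ, 0 < μ ∧ Module.End.HasEigenvalue (Matrix.toLin' A) μ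

open scoped MatrixOrder in
/-- The positive semidefinite square root `P^{1/2}` of a positive semidefinite matrix. -/
noncomputable def matSqrt {p : ℕ} (P : Matrix (Fin p) (Fin p) ℝ) : Matrix (Fin p) (Fin p) ℝ :=
  CFC.sqrt P

/-- The weighted norm `‖x‖_{2,R} = ‖R x‖₂`. -/
noncomputable def weightedNorm {p : ℕ} (R : Matrix (Fin p) (Fin p) ℝ) (x : Vec p) : ℝ :=
  ‖(WithLp.toLp 2 (R *ᵥ x.ofLp) : Vec p)‖

open scoped Matrix.Norms.L2Operator in
/-- The matrix norm `‖A‖₂` induced by the Euclidean norms. -/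
noncomputable def inducedNorm {p q : ℕ} (A : Matrix (Fin p) (Fin q) ℝ) : ℝ := ‖A‖

/-- The Jacobian matrix `(∂fᵢ/∂zⱼ)(z)` of a differentiable function. -/
noncomputable def jacobian {n p : ℕ} (f : Vec n → Vec p) (z : Vec n) :
    Matrix (Fin p) (Fin n) ℝ :=
  Matrix.of fun i j => fderiv ℝ f z (EuclideanSpace.single j 1) i

/-- The symmetric matrix
`[A 0 0; 0 0 B; 0 Bᵀ I] - α [N 0; 0 0]`, with rows and columns partitioned as `(m + k) + q`. -/
def lmiMatrix {m k : ℕ} {q : Type*} [Fintype q] [DecidableEq q] (A : Matrix (Fin m) (Fin m) ℝ)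
    (B : Matrix (Fin k) q ℝ) (N : Matrix (Fin m ⊕ Fin k) (Fin m ⊕ Fin k) ℝ) (α : ℝ) :
    Matrix ((Fin m ⊕ Fin k) ⊕ q) ((Fin m ⊕ Fin k) ⊕ q) ℝ :=
  fromBlocks (fromBlocks A 0 0 0) (fromRows 0 B) (fromCols 0 Bᵀ) 1 - α • fromBlocks N 0 0 0

end SetValuedRegression

/-!
Both bounds say that the sets of solutions of two quadratic matrix inequalities are nested. With
`B` the scaled difference of basis vectors, respectively the Jacobian of the basis, the bound at a
parameter `θ` reads `(θᵀ B)(θᵀ B)ᵀ ≤ A`, where `A` is `L² P⁻¹`, respectively `L² I`; that is,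
`θ ∈ 𝒵(M)` with `M = diag(A, -B Bᵀ)`. By a Schur complement the linear matrix inequality is
`M - α N ≥ 0`. What remains is the matrix S-lemma `qmiSet_subset_qmiSet_iff`: `𝒵(N) ⊆ 𝒵(M)` iff
`M - α N ≥ 0` for some `α ≥ 0`.

One direction is immediate. For the other one, the scalar S-lemma `exists_posSemidef_sub_smul`
reduces the claim to vectors: if the form of `N` is nonnegative at `x = (ξ, η)`, so is that of `M`.
If `ξ ≠ 0`, the vector lies on the graph of some `Z ∈ 𝒵(N)` (`exists_mem_qmiSet_mulVec_eq`), by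
completing the square in `N` and interpolating with a matrix of rank one. If `ξ = 0`, then
`N₂₂ ≤ 0` puts `x` into `ker N`, so `𝒵(N)` contains a line in the direction of `η`, and boundedness
below of the form of `M` along this line gives the claim. The positive eigenvalue of `N` is the
Slater condition of the scalar S-lemma; it also provides the vector with `ξ ≠ 0` on which the line
is built. The properties of `N` that this uses are that `N₂₂ ≤ 0` with `(0, η) ∈ ker N` for
`η ∈ ker N₂₂`, which follow from `Π₂₂ < 0`, and that `𝒵(N)` is nonempty, since it contains the
true parameter.
-/

namespace SetValuedRegression

open Matrix

/-! ### Quadratic forms of real matrices -/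

theorem dotProduct_mulVec_comm_of_isSymm {ι : Type*} [Fintype ι] {A : Matrix ι ι ℝ}
    (hA : A.IsSymm) (x y : ι → ℝ) : x ⬝ᵥ A *ᵥ y = y ⬝ᵥ A *ᵥ x := by
  rw [dotProduct_mulVec, ← mulVec_transpose, hA.eq, dotProduct_comm]

theorem quadForm_add {ι : Type*} [Fintype ι] {A : Matrix ι ι ℝ} (hA : A.IsSymm) (x y : ι → ℝ) :
    (x + y) ⬝ᵥ A *ᵥ (x + y) = x ⬝ᵥ A *ᵥ x + 2 * (x ⬝ᵥ A *ᵥ y) + y ⬝ᵥ A *ᵥ y := by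
  have h := dotProduct_mulVec_comm_of_isSymm hA x y
  simp only [mulVec_add, add_dotProduct, dotProduct_add]
  linarith

theorem quadForm_smul {ι : Type*} [Fintype ι] (A : Matrix ι ι ℝ) (t : ℝ) (x : ι → ℝ) :
    (t • x) ⬝ᵥ A *ᵥ (t • x) = t ^ 2 * (x ⬝ᵥ A *ᵥ x) := by
  simp only [mulVec_smul, smul_dotProduct, dotProduct_smul, smul_eq_mul]
  ring

theorem quadForm_add_smul {ι : Type*} [Fintype ι] {A : Matrix ι ι ℝ} (hA : A.IsSymm)
    (x y : ι → ℝ) (t : ℝ) :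
    (x + t • y) ⬝ᵥ A *ᵥ (x + t • y) =
      x ⬝ᵥ A *ᵥ x + 2 * t * (x ⬝ᵥ A *ᵥ y) + t ^ 2 * (y ⬝ᵥ A *ᵥ y) := by
  rw [quadForm_add hA, quadForm_smul, mulVec_smul, dotProduct_smul, smul_eq_mul]
  ring

theorem posSemidef_iff_isSymm_quadForm {ι : Type*} [Fintype ι] {A : Matrix ι ι ℝ} :
    A.PosSemidef ↔ A.IsSymm ∧ ∀ x : ι → ℝ, 0 ≤ x ⬝ᵥ A *ᵥ x := by
  rw [posSemidef_iff_dotProduct_mulVec]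
  simp only [star_trivial, IsHermitian, IsSymm, conjTranspose_eq_transpose_of_trivial]

theorem quadForm_transpose_mul_mul {ι κ : Type*} [Fintype ι] [Fintype κ] (A : Matrix ι ι ℝ)
    (B : Matrix ι κ ℝ) (x : κ → ℝ) :
    x ⬝ᵥ (Bᵀ * A * B) *ᵥ x = (B *ᵥ x) ⬝ᵥ A *ᵥ (B *ᵥ x) := by
  rw [← mulVec_mulVec, ← mulVec_mulVec, dotProduct_mulVec x, vecMul_transpose]

/-- The Cauchy–Schwarz inequality for the semi-inner product of a positive semidefinite matrix. -/
theorem dotProduct_mulVec_sq_le {ι : Type*} [Fintype ι] {A : Matrix ι ι ℝ}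
    (hA : A.PosSemidef) (x y : ι → ℝ) :
    (x ⬝ᵥ A *ᵥ y) ^ 2 ≤ (x ⬝ᵥ A *ᵥ x) * (y ⬝ᵥ A *ᵥ y) := by
  obtain ⟨hs, hn⟩ := posSemidef_iff_isSymm_quadForm.1 hA
  have h := discrim_le_zero (a := y ⬝ᵥ A *ᵥ y) (b := 2 * (x ⬝ᵥ A *ᵥ y)) (c := x ⬝ᵥ A *ᵥ x)
    fun t => by
      have := hn (x + t • y)
      rw [quadForm_add_smul hs] at this
      linarith
  rw [discrim] at h
  linarith

theorem mulVec_eq_zero_of_quadForm_nonpos {ι : Type*} [Fintype ι] {A : Matrix ι ι ℝ}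
    (hA : A.PosSemidef) {x : ι → ℝ} (hx : x ⬝ᵥ A *ᵥ x ≤ 0) : A *ᵥ x = 0 := by
  have h0 := (posSemidef_iff_isSymm_quadForm.1 hA).2 x
  have h := dotProduct_mulVec_sq_le hA (A *ᵥ x) x
  rw [le_antisymm hx h0, mul_zero] at h
  exact dotProduct_self_eq_zero.1 (pow_eq_zero_iff two_ne_zero |>.1 (le_antisymm h (sq_nonneg _)))

/-- Solvability of `A z = v` for symmetric `A`: it suffices that `v` is orthogonal to `ker A`. -/
theorem exists_mulVec_eq_of_isSymm {ι : Type*} [Fintype ι] [DecidableEq ι] {A : Matrix ι ι ℝ}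
    (hA : A.IsSymm) (v : ι → ℝ) (hv : ∀ x, A *ᵥ x = 0 → v ⬝ᵥ x = 0) : ∃ z, A *ᵥ z = v := by
  have hsym : (toEuclideanLin A).IsSymmetric :=
    isSymmetric_toEuclideanLin_iff.2 (by
      rw [IsHermitian, conjTranspose_eq_transpose_of_trivial, hA.eq])
  have hmem : WithLp.toLp 2 v ∈ LinearMap.range (toEuclideanLin A) := by
    rw [← Submodule.orthogonal_orthogonal (LinearMap.range (toEuclideanLin A)),
      hsym.orthogonal_range, Submodule.mem_orthogonal]
    intro x hx
    have hx' : A *ᵥ x.ofLp = 0 := congrArg WithLp.ofLp (LinearMap.mem_ker.1 hx)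
    have := hv _ hx'
    rw [EuclideanSpace.inner_eq_star_dotProduct]
    simpa using this
  obtain ⟨z, hz⟩ := hmem
  exact ⟨z.ofLp, congrArg WithLp.ofLp hz⟩

/-! ### The S-lemma -/

/-- On the plane spanned by `x` and `y`, where `N` is indefinite, the form of `N` vanishes at two
points `x + t • y` with `t` of opposite signs. Adding the inequalities for `M` at these two points,
with weights that cancel the mixed term, compares `M` at `x` and at `y`. -/
theorem mul_le_mul_of_quadForm_nonneg_imp {ι : Type*} [Fintype ι] {M N : Matrix ι ι ℝ}
    (hM : M.IsSymm) (hN : N.IsSymm)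
    (h : ∀ x : ι → ℝ, 0 ≤ x ⬝ᵥ N *ᵥ x → 0 ≤ x ⬝ᵥ M *ᵥ x) {x y : ι → ℝ}
    (hx : 0 < x ⬝ᵥ N *ᵥ x) (hy : y ⬝ᵥ N *ᵥ y < 0) :
    (x ⬝ᵥ M *ᵥ x) * (y ⬝ᵥ N *ᵥ y) ≤ (x ⬝ᵥ N *ᵥ x) * (y ⬝ᵥ M *ᵥ y) := by
  set a := x ⬝ᵥ N *ᵥ x
  set c := y ⬝ᵥ N *ᵥ y
  set b := x ⬝ᵥ N *ᵥ y
  have key : ∀ t : ℝ, a + 2 * t * b + t ^ 2 * c = 0 →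
      0 ≤ x ⬝ᵥ M *ᵥ x + 2 * t * (x ⬝ᵥ M *ᵥ y) + t ^ 2 * (y ⬝ᵥ M *ᵥ y) := by
    intro t ht
    rw [← quadForm_add_smul hM]
    apply h
    rw [quadForm_add_smul hN]
    exact ht.ge
  set s := Real.sqrt (b ^ 2 - a * c)
  have hac : a * c < 0 := mul_neg_of_pos_of_neg hx hy
  have hs : s ^ 2 = b ^ 2 - a * c := Real.sq_sqrt (by nlinarith [sq_nonneg b])
  have hs0 : 0 ≤ s := Real.sqrt_nonneg _
  have hsb : |b| < s := abs_lt_of_sq_lt_sq (by linarith) hs0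
  obtain ⟨hb1, hb2⟩ := abs_lt.1 hsb
  have hc : c ≠ 0 := hy.ne
  have h1 := key ((-b + s) / c) (by field_simp; linear_combination hs)
  have h2 := key ((-b - s) / c) (by field_simp; linear_combination hs)
  set p := x ⬝ᵥ M *ᵥ x
  set q := x ⬝ᵥ M *ᵥ y
  set r := y ⬝ᵥ M *ᵥ y
  have e : (b + s) * (p + 2 * ((-b + s) / c) * q + ((-b + s) / c) ^ 2 * r) +
      (s - b) * (p + 2 * ((-b - s) / c) * q + ((-b - s) / c) ^ 2 * r) =
      2 * s * (p - a * r / c) := by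
    field_simp
    linear_combination (2 * s * r) * hs
  have e2 : 0 ≤ 2 * s * (p - a * r / c) := by
    rw [← e]
    exact add_nonneg (mul_nonneg (by linarith) h1) (mul_nonneg (by linarith) h2)
  have e3 : 0 ≤ p - a * r / c := nonneg_of_mul_nonneg_right e2 (by linarith)
  have e4 := mul_nonpos_of_nonneg_of_nonpos e3 hy.le
  rw [sub_mul, div_mul_cancel₀ _ hc] at e4
  linarith

/-- The lossless S-lemma for homogeneous quadratic forms. The multiplier is the infimum of the
quotients of the two forms over the points where the form of `N` is positive. -/
theorem exists_posSemidef_sub_smul {ι : Type*} [Fintype ι] {M N : Matrix ι ι ℝ}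
    (hM : M.IsSymm) (hN : N.IsSymm) (hpos : ∃ x : ι → ℝ, 0 < x ⬝ᵥ N *ᵥ x)
    (h : ∀ x : ι → ℝ, 0 ≤ x ⬝ᵥ N *ᵥ x → 0 ≤ x ⬝ᵥ M *ᵥ x) :
    ∃ α : ℝ, 0 ≤ α ∧ (M - α • N).PosSemidef := by
  let S : Set ℝ := (fun x : ι → ℝ => (x ⬝ᵥ M *ᵥ x) / (x ⬝ᵥ N *ᵥ x)) '' {x | 0 < x ⬝ᵥ N *ᵥ x}
  have hSne : S.Nonempty := Set.Nonempty.image _ hpos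
  have hS0 : ∀ s ∈ S, 0 ≤ s := by
    rintro _ ⟨x, hx, rfl⟩
    exact div_nonneg (h x (le_of_lt hx)) (le_of_lt hx)
  refine ⟨sInf S, le_csInf hSne hS0, posSemidef_iff_isSymm_quadForm.2
    ⟨hM.sub (hN.smul _), fun x => ?_⟩⟩
  rw [sub_mulVec, smul_mulVec, dotProduct_sub, dotProduct_smul, smul_eq_mul, sub_nonneg]
  rcases lt_trichotomy (x ⬝ᵥ N *ᵥ x) 0 with hx | hx | hx
  · rw [← div_le_iff_of_neg hx]
    refine le_csInf hSne ?_
    rintro _ ⟨y, hy, rfl⟩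
    rw [div_le_iff_of_neg hx, div_mul_eq_mul_div, div_le_iff₀ hy, mul_comm (x ⬝ᵥ M *ᵥ x)]
    exact mul_le_mul_of_quadForm_nonneg_imp hM hN h hy hx
  · rw [hx, mul_zero]
    exact h x hx.ge
  · rw [← le_div_iff₀ hx]
    exact csInf_le ⟨0, hS0⟩ ⟨x, hx, rfl⟩

/-! ### Quadratic matrix inequalities -/

theorem fromRows_one_mulVec {u v : ℕ} (Z : Matrix (Fin v) (Fin u) ℝ) (ξ : Fin u → ℝ) :
    fromRows (1 : Matrix (Fin u) (Fin u) ℝ) Z *ᵥ ξ = Sum.elim ξ (Z *ᵥ ξ) := by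
  rw [fromRows_mulVec, one_mulVec]

theorem mem_qmiSet_iff {u v : ℕ} {M : Matrix (Fin u ⊕ Fin v) (Fin u ⊕ Fin v) ℝ} (hM : M.IsSymm)
    {Z : Matrix (Fin v) (Fin u) ℝ} :
    Z ∈ qmiSet M ↔ ∀ ξ, 0 ≤ Sum.elim ξ (Z *ᵥ ξ) ⬝ᵥ M *ᵥ Sum.elim ξ (Z *ᵥ ξ) := by
  rw [qmiSet, Set.mem_ofPred_eq, posSemidef_iff_isSymm_quadForm]
  simp only [quadForm_transpose_mul_mul, fromRows_one_mulVec, and_iff_right_iff_imp]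
  intro _
  simp only [IsSymm, transpose_mul, transpose_transpose, hM.eq, Matrix.mul_assoc]

theorem quadForm_elim_zero {u v : ℕ} (M : Matrix (Fin u ⊕ Fin v) (Fin u ⊕ Fin v) ℝ)
    (η : Fin v → ℝ) :
    Sum.elim (0 : Fin u → ℝ) η ⬝ᵥ M *ᵥ Sum.elim (0 : Fin u → ℝ) η =
      η ⬝ᵥ M.toBlocks₂₂ *ᵥ η := by
  conv_lhs => rw [← fromBlocks_toBlocks M]
  simp [fromBlocks_mulVec]

theorem elim_add_smul_elim {u v : ℕ} (ξ : Fin u → ℝ) (a b : Fin v → ℝ) (t : ℝ) :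
    Sum.elim ξ (a + t • b) = Sum.elim ξ a + t • Sum.elim (0 : Fin u → ℝ) b := by
  ext (i | i) <;> simp

/-- A rank one matrix solves the interpolation problem `X ξ = η` under the bound `Xᵀ R X ≤ S`
as soon as the bound holds at `ξ`. -/
theorem exists_mulVec_eq_quadForm_le {u v : ℕ} {S : Matrix (Fin u) (Fin u) ℝ}
    {R : Matrix (Fin v) (Fin v) ℝ} (hS : S.PosSemidef) (hR : R.PosSemidef) {ξ : Fin u → ℝ}
    (hξ : ξ ≠ 0) {η : Fin v → ℝ} (h : η ⬝ᵥ R *ᵥ η ≤ ξ ⬝ᵥ S *ᵥ ξ) :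
    ∃ X : Matrix (Fin v) (Fin u) ℝ, X *ᵥ ξ = η ∧
      ∀ x, (X *ᵥ x) ⬝ᵥ R *ᵥ (X *ᵥ x) ≤ x ⬝ᵥ S *ᵥ x := by
  have hS0 := (posSemidef_iff_isSymm_quadForm.1 hS).2
  have hvec : ∀ (a : Fin u → ℝ) (x : Fin u → ℝ), vecMulVec η a *ᵥ x = (a ⬝ᵥ x) • η := by
    intro a x
    rw [vecMulVec_mulVec]
    ext i
    simp [mul_comm]
  rcases (hS0 ξ).eq_or_lt with hz | hp
  · have hR0 : R *ᵥ η = 0 := mulVec_eq_zero_of_quadForm_nonpos hR (hz ▸ h)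
    have hne : ξ ⬝ᵥ ξ ≠ 0 := fun h0 => hξ (dotProduct_self_eq_zero.1 h0)
    refine ⟨vecMulVec η ((ξ ⬝ᵥ ξ)⁻¹ • ξ), ?_, fun x => ?_⟩
    · rw [hvec, smul_dotProduct, smul_eq_mul, inv_mul_cancel₀ hne, one_smul]
    · rw [hvec, quadForm_smul, hR0, dotProduct_zero, mul_zero]
      exact hS0 x
  · refine ⟨vecMulVec η ((ξ ⬝ᵥ S *ᵥ ξ)⁻¹ • (S *ᵥ ξ)), ?_, fun x => ?_⟩
    · rw [hvec, smul_dotProduct, smul_eq_mul, dotProduct_comm (S *ᵥ ξ), inv_mul_cancel₀ hp.ne',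
        one_smul]
    · rw [hvec, quadForm_smul, smul_dotProduct, smul_eq_mul, dotProduct_comm (S *ᵥ ξ), mul_pow,
        inv_pow]
      have hcs := dotProduct_mulVec_sq_le hS x ξ
      rw [mul_assoc, inv_mul_le_iff₀ (by positivity)]
      calc (x ⬝ᵥ S *ᵥ ξ) ^ 2 * (η ⬝ᵥ R *ᵥ η)
          ≤ (x ⬝ᵥ S *ᵥ ξ) ^ 2 * (ξ ⬝ᵥ S *ᵥ ξ) := by gcongr
        _ ≤ (x ⬝ᵥ S *ᵥ x) * (ξ ⬝ᵥ S *ᵥ ξ) * (ξ ⬝ᵥ S *ᵥ ξ) := by gcongr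
        _ = _ := by ring

/-- Completing the square: the form of `N` splits along the graph of a centre `Z`, a solution of
`N₂₂ Z = -N₂₁`. It exists because `ker N₂₂` is contained in `ker N₁₂`. -/
theorem exists_quadForm_centre {u v : ℕ} {N : Matrix (Fin u ⊕ Fin v) (Fin u ⊕ Fin v) ℝ}
    (hN : N.IsSymm)
    (hker : ∀ η, N.toBlocks₂₂ *ᵥ η = 0 → N *ᵥ Sum.elim (0 : Fin u → ℝ) η = 0) :
    ∃ Z : Matrix (Fin v) (Fin u) ℝ, ∀ ξ η,
      Sum.elim ξ (Z *ᵥ ξ + η) ⬝ᵥ N *ᵥ Sum.elim ξ (Z *ᵥ ξ + η) =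
        Sum.elim ξ (Z *ᵥ ξ) ⬝ᵥ N *ᵥ Sum.elim ξ (Z *ᵥ ξ) + η ⬝ᵥ N.toBlocks₂₂ *ᵥ η := by
  have h22 : N.toBlocks₂₂.IsSymm := by
    ext i j
    exact congrFun (congrFun hN (Sum.inr i)) (Sum.inr j)
  have hsolve : ∀ j : Fin u, ∃ z, N.toBlocks₂₂ *ᵥ z = -(N.toBlocks₂₁ *ᵥ Pi.single j 1) := by
    intro j
    refine exists_mulVec_eq_of_isSymm h22 _ fun x hx => ?_
    have h0 : ∑ i, N (Sum.inl j) (Sum.inr i) * x i = 0 := by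
      simpa [mulVec, dotProduct, Fintype.sum_sum_type] using congrFun (hker x hx) (Sum.inl j)
    rw [neg_dotProduct, neg_eq_zero, mulVec_single_one, ← h0]
    exact Finset.sum_congr rfl fun i _ => congrArg (· * x i) (hN.apply (Sum.inl j) (Sum.inr i))
  choose z hz using hsolve
  refine ⟨(Matrix.of z)ᵀ, fun ξ η => ?_⟩
  have hZ : N.toBlocks₂₁ + N.toBlocks₂₂ * (Matrix.of z)ᵀ = 0 := by
    ext i j
    have := congrFun (hz j) i
    rw [Pi.neg_apply, mulVec_single_one] at this
    rw [Matrix.add_apply, Matrix.zero_apply, add_eq_zero_iff_eq_neg']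
    exact this
  have hsplit : Sum.elim ξ ((Matrix.of z)ᵀ *ᵥ ξ + η) =
      Sum.elim ξ ((Matrix.of z)ᵀ *ᵥ ξ) + Sum.elim (0 : Fin u → ℝ) η := by
    ext (i | i) <;> simp
  have hcross : Sum.elim ξ ((Matrix.of z)ᵀ *ᵥ ξ) ⬝ᵥ N *ᵥ Sum.elim (0 : Fin u → ℝ) η = 0 := by
    rw [dotProduct_mulVec_comm_of_isSymm hN, ← fromBlocks_toBlocks N]
    simp [fromBlocks_mulVec, ← add_mulVec, hZ]
  rw [hsplit, quadForm_add hN, hcross, quadForm_elim_zero]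
  ring

/-- Every vector `(ξ, η)` with `ξ ≠ 0` at which the form of `N` is nonnegative lies on the graph
of a solution of the quadratic matrix inequality. -/
theorem exists_mem_qmiSet_mulVec_eq {u v : ℕ} {N : Matrix (Fin u ⊕ Fin v) (Fin u ⊕ Fin v) ℝ}
    (hN : N.IsSymm) (h22 : (-N.toBlocks₂₂).PosSemidef)
    (hker : ∀ η, N.toBlocks₂₂ *ᵥ η = 0 → N *ᵥ Sum.elim (0 : Fin u → ℝ) η = 0)
    (hne : (qmiSet N).Nonempty) {ξ : Fin u → ℝ} (hξ : ξ ≠ 0) {η : Fin v → ℝ}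
    (h : 0 ≤ Sum.elim ξ η ⬝ᵥ N *ᵥ Sum.elim ξ η) : ∃ Z ∈ qmiSet N, Z *ᵥ ξ = η := by
  obtain ⟨C, hC⟩ := exists_quadForm_centre hN hker
  obtain ⟨Z₀, hZ₀⟩ := hne
  rw [mem_qmiSet_iff hN] at hZ₀
  have hneg : ∀ x, x ⬝ᵥ N.toBlocks₂₂ *ᵥ x ≤ 0 := fun x => by
    have := (posSemidef_iff_isSymm_quadForm.1 h22).2 x
    rw [neg_mulVec, dotProduct_neg] at this
    linarith
  -- The centre maximizes the form, so it is a solution because some solution exists.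
  have hCmem : C ∈ qmiSet N := by
    rw [mem_qmiSet_iff hN]
    intro x
    have h1 := hC x (Z₀ *ᵥ x - C *ᵥ x)
    rw [add_sub_cancel] at h1
    have h2 := hZ₀ x
    have h3 := hneg (Z₀ *ᵥ x - C *ᵥ x)
    linarith
  have hquad : ∀ x : Fin u → ℝ,
      x ⬝ᵥ ((fromRows (1 : Matrix (Fin u) (Fin u) ℝ) C)ᵀ * N *
        fromRows (1 : Matrix (Fin u) (Fin u) ℝ) C) *ᵥ x =
        Sum.elim x (C *ᵥ x) ⬝ᵥ N *ᵥ Sum.elim x (C *ᵥ x) := fun x => by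
    rw [quadForm_transpose_mul_mul, fromRows_one_mulVec]
  obtain ⟨X, hX, hXle⟩ := exists_mulVec_eq_quadForm_le (η := η - C *ᵥ ξ) hCmem h22 hξ (by
    have h1 := hC ξ (η - C *ᵥ ξ)
    rw [add_sub_cancel] at h1
    rw [hquad, neg_mulVec, dotProduct_neg]
    linarith)
  refine ⟨C + X, (mem_qmiSet_iff hN).2 fun x => ?_, ?_⟩
  · have h1 := hXle x
    rw [hquad, neg_mulVec, dotProduct_neg] at h1
    rw [add_mulVec, hC]
    linarith
  · rw [add_mulVec, hX, add_sub_cancel]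

theorem leadingCoeff_nonneg_of_forall_quadratic_nonneg {a b c : ℝ}
    (h : ∀ t : ℝ, 0 ≤ c + 2 * t * b + t ^ 2 * a) : 0 ≤ a := by
  by_contra! ha
  have hc : 0 ≤ c := by simpa using h 0
  -- Averaging over `t` and `-t` removes the linear term.
  have h1 := h (1 + c / -a)
  have h2 := h (-(1 + c / -a))
  have ht : 0 ≤ c / -a := div_nonneg hc (neg_nonneg.2 ha.le)
  have h3 : c / -a * -a = c := div_mul_cancel₀ _ (neg_ne_zero.2 ha.ne)
  nlinarith [mul_nonneg ht hc]

theorem HasPosEigenvalue.exists_quadForm_pos {ι : Type*} [Fintype ι] [DecidableEq ι]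
    {A : Matrix ι ι ℝ} (hA : HasPosEigenvalue A) : ∃ x : ι → ℝ, 0 < x ⬝ᵥ A *ᵥ x := by
  obtain ⟨μ, hμ, hv⟩ := hA
  obtain ⟨x, hx⟩ := hv.exists_hasEigenvector
  refine ⟨x, ?_⟩
  have h1 : A *ᵥ x = μ • x := by simpa using hx.apply_eq_smul
  rw [h1, dotProduct_smul, smul_eq_mul]
  have h2 : 0 < x ⬝ᵥ x := by
    refine lt_of_le_of_ne (Finset.sum_nonneg fun i _ => mul_self_nonneg _) fun h0 => hx.2 ?_
    exact dotProduct_self_eq_zero.1 h0.symm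
  positivity

/-- The matrix S-lemma. The positive eigenvalue is the Slater condition; the conditions on the lower
right block make the solution set large enough to see every vector at which the form of `N` is
nonnegative. -/
theorem qmiSet_subset_qmiSet_iff {u v : ℕ} {M N : Matrix (Fin u ⊕ Fin v) (Fin u ⊕ Fin v) ℝ}
    (hM : M.IsSymm) (hN : N.IsSymm) (h22 : (-N.toBlocks₂₂).PosSemidef)
    (hker : ∀ η, N.toBlocks₂₂ *ᵥ η = 0 → N *ᵥ Sum.elim (0 : Fin u → ℝ) η = 0)
    (hne : (qmiSet N).Nonempty) (hpos : HasPosEigenvalue N) :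
    qmiSet N ⊆ qmiSet M ↔ ∃ α : ℝ, 0 ≤ α ∧ (M - α • N).PosSemidef := by
  constructor
  · intro hsub
    obtain ⟨x₀, hx₀⟩ := hpos.exists_quadForm_pos
    refine exists_posSemidef_sub_smul hM hN ⟨x₀, hx₀⟩ fun x hx => ?_
    obtain ⟨ξ, η, rfl⟩ : ∃ ξ η, x = Sum.elim ξ η := ⟨_, _, (Sum.elim_comp_inl_inr x).symm⟩
    obtain ⟨ξ₀, η₀, rfl⟩ : ∃ ξ η, x₀ = Sum.elim ξ η := ⟨_, _, (Sum.elim_comp_inl_inr x₀).symm⟩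
    have hneg : ∀ x, 0 ≤ x ⬝ᵥ N.toBlocks₂₂ *ᵥ x → N.toBlocks₂₂ *ᵥ x = 0 := fun x hx => by
      rw [← neg_eq_zero, ← neg_mulVec]
      refine mulVec_eq_zero_of_quadForm_nonpos h22 ?_
      rw [neg_mulVec, dotProduct_neg]
      linarith
    by_cases hξ : ξ = 0
    · -- A direction `(0, η)` in `ker N`: solutions may be translated along `η` without bound.
      subst hξ
      rw [quadForm_elim_zero] at hx
      have hk := hker η (hneg η hx)
      have hξ₀ : ξ₀ ≠ 0 := by
        rintro rfl
        rw [quadForm_elim_zero] at hx₀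
        rw [hneg η₀ hx₀.le, dotProduct_zero] at hx₀
        exact hx₀.false
      have hs : ξ₀ ⬝ᵥ ξ₀ ≠ 0 := fun h0 => hξ₀ (dotProduct_self_eq_zero.1 h0)
      obtain ⟨Z₀, hZ₀⟩ := hne
      have hline : ∀ (t : ℝ) (x : Fin u → ℝ), (Z₀ + t • vecMulVec η ξ₀) *ᵥ x =
          Z₀ *ᵥ x + (t * (ξ₀ ⬝ᵥ x)) • η := by
        intro t x
        rw [add_mulVec, smul_mulVec, vecMulVec_mulVec]
        ext i
        simp
        ring
      have hmem : ∀ t : ℝ, Z₀ + t • vecMulVec η ξ₀ ∈ qmiSet M := by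
        intro t
        apply hsub
        rw [mem_qmiSet_iff hN] at hZ₀ ⊢
        intro x
        rw [hline, elim_add_smul_elim, quadForm_add_smul hN, hk, dotProduct_zero, dotProduct_zero,
          mul_zero, mul_zero, add_zero, add_zero]
        exact hZ₀ x
      refine leadingCoeff_nonneg_of_forall_quadratic_nonneg
        (c := Sum.elim ξ₀ (Z₀ *ᵥ ξ₀) ⬝ᵥ M *ᵥ Sum.elim ξ₀ (Z₀ *ᵥ ξ₀))
        (b := Sum.elim ξ₀ (Z₀ *ᵥ ξ₀) ⬝ᵥ M *ᵥ Sum.elim (0 : Fin u → ℝ) η) fun t => ?_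
      have h1 := (mem_qmiSet_iff hM).1 (hmem (t / (ξ₀ ⬝ᵥ ξ₀))) ξ₀
      rwa [hline, div_mul_cancel₀ _ hs, elim_add_smul_elim, quadForm_add_smul hM] at h1
    · obtain ⟨Z, hZ, rfl⟩ := exists_mem_qmiSet_mulVec_eq hN h22 hker hne hξ hx
      exact (mem_qmiSet_iff hM).1 (hsub hZ) ξ
  · rintro ⟨α, hα, h⟩ Z hZ
    rw [mem_qmiSet_iff hN] at hZ
    rw [mem_qmiSet_iff hM]
    intro ξ
    have h1 := (posSemidef_iff_isSymm_quadForm.1 h).2 (Sum.elim ξ (Z *ᵥ ξ))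
    rw [sub_mulVec, smul_mulVec, dotProduct_sub, dotProduct_smul, smul_eq_mul] at h1
    have h2 := mul_nonneg hα (hZ ξ)
    linarith

/-! ### The data matrix -/

theorem dataMatrix_isSymm {m k T : ℕ} {Pi : Matrix (Fin m ⊕ Fin T) (Fin m ⊕ Fin T) ℝ}
    (hPi : Pi.IsSymm) (Y : Matrix (Fin m) (Fin T) ℝ) (Phi : Matrix (Fin k) (Fin T) ℝ) :
    (dataMatrix Pi Y Phi).IsSymm := by
  simp only [dataMatrix, IsSymm, transpose_mul, transpose_transpose, hPi.eq, Matrix.mul_assoc]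

theorem dataMatrix_toBlocks₂₂ {m k T : ℕ} (Pi : Matrix (Fin m ⊕ Fin T) (Fin m ⊕ Fin T) ℝ)
    (Y : Matrix (Fin m) (Fin T) ℝ) (Phi : Matrix (Fin k) (Fin T) ℝ) :
    (dataMatrix Pi Y Phi).toBlocks₂₂ = Phi * Pi.toBlocks₂₂ * Phiᵀ := by
  conv_lhs => rw [← fromBlocks_toBlocks Pi]
  simp only [dataMatrix, fromBlocks_transpose, fromBlocks_multiply, toBlocks_fromBlocks₂₂]
  simp

theorem dataMatrix_mulVec_eq_zero {m k T : ℕ} {Pi : Matrix (Fin m ⊕ Fin T) (Fin m ⊕ Fin T) ℝ}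
    (hPi : (-Pi.toBlocks₂₂).PosDef) (Y : Matrix (Fin m) (Fin T) ℝ)
    (Phi : Matrix (Fin k) (Fin T) ℝ) {η : Fin k → ℝ}
    (hη : (dataMatrix Pi Y Phi).toBlocks₂₂ *ᵥ η = 0) :
    dataMatrix Pi Y Phi *ᵥ Sum.elim (0 : Fin m → ℝ) η = 0 := by
  have h0 : Phiᵀ *ᵥ η = 0 := by
    by_contra hne
    have h1 := hPi.dotProduct_mulVec_pos hne
    have h2 := quadForm_transpose_mul_mul Pi.toBlocks₂₂ Phiᵀ η
    rw [transpose_transpose, ← dataMatrix_toBlocks₂₂ Pi Y, hη, dotProduct_zero] at h2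
    rw [star_trivial, neg_mulVec, dotProduct_neg, ← h2, neg_zero] at h1
    exact h1.false
  have h3 : (fromBlocks (1 : Matrix (Fin m) (Fin m) ℝ) Y (0 : Matrix (Fin k) (Fin m) ℝ) (-Phi))ᵀ *ᵥ
      Sum.elim (0 : Fin m → ℝ) η = 0 := by
    simp [fromBlocks_transpose, fromBlocks_mulVec, h0, neg_mulVec]
  rw [dataMatrix, ← mulVec_mulVec, h3, mulVec_zero]

theorem neg_dataMatrix_toBlocks₂₂_posSemidef {m k T : ℕ}
    {Pi : Matrix (Fin m ⊕ Fin T) (Fin m ⊕ Fin T) ℝ} (hPi : (-Pi.toBlocks₂₂).PosDef)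
    (Y : Matrix (Fin m) (Fin T) ℝ) (Phi : Matrix (Fin k) (Fin T) ℝ) :
    (-(dataMatrix Pi Y Phi).toBlocks₂₂).PosSemidef := by
  have := hPi.posSemidef.mul_mul_conjTranspose_same Phi
  rwa [Matrix.mul_neg, Matrix.neg_mul, conjTranspose_eq_transpose_of_trivial,
    ← dataMatrix_toBlocks₂₂ Pi Y] at this

/-- A parameter is compatible with the data iff its residual satisfies the noise model. -/
theorem mem_qmiSet_dataMatrix_iff {m k T : ℕ} {Pi : Matrix (Fin m ⊕ Fin T) (Fin m ⊕ Fin T) ℝ}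
    {Y : Matrix (Fin m) (Fin T) ℝ} {Phi : Matrix (Fin k) (Fin T) ℝ}
    {θ : Matrix (Fin k) (Fin m) ℝ} :
    θ ∈ qmiSet (dataMatrix Pi Y Phi) ↔ (Y - θᵀ * Phi)ᵀ ∈ qmiSet Pi := by
  have h : (fromBlocks (1 : Matrix (Fin m) (Fin m) ℝ) Y (0 : Matrix (Fin k) (Fin m) ℝ) (-Phi))ᵀ *
      fromRows (1 : Matrix (Fin m) (Fin m) ℝ) θ =
      fromRows (1 : Matrix (Fin m) (Fin m) ℝ) (Y - θᵀ * Phi)ᵀ := by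
    rw [fromBlocks_transpose, ← fromRows_fromCols_eq_fromBlocks, fromRows_mul, fromCols_mul_fromRows,
      fromCols_mul_fromRows]
    simp [sub_eq_add_neg]
  have h2 : (fromRows (1 : Matrix (Fin m) (Fin m) ℝ) θ)ᵀ * dataMatrix Pi Y Phi *
      fromRows (1 : Matrix (Fin m) (Fin m) ℝ) θ =
      (fromRows (1 : Matrix (Fin m) (Fin m) ℝ) (Y - θᵀ * Phi)ᵀ)ᵀ * Pi *
      fromRows (1 : Matrix (Fin m) (Fin m) ℝ) (Y - θᵀ * Phi)ᵀ := by
    rw [← h]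
    simp only [dataMatrix, transpose_mul, transpose_transpose, Matrix.mul_assoc]
  rw [qmiSet, qmiSet, Set.mem_ofPred_eq, Set.mem_ofPred_eq, h2]

/-! ### The linear matrix inequality -/

theorem lmiMatrix_posSemidef_iff {m k : ℕ} {q : Type*} [Fintype q] [DecidableEq q]
    (A : Matrix (Fin m) (Fin m) ℝ) (B : Matrix (Fin k) q ℝ)
    (N : Matrix (Fin m ⊕ Fin k) (Fin m ⊕ Fin k) ℝ) (α : ℝ) :
    (lmiMatrix A B N α).PosSemidef ↔
      (fromBlocks A 0 0 (-(B * Bᵀ)) - α • N).PosSemidef := by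
  have h1 : lmiMatrix A B N α = fromBlocks (fromBlocks A 0 0 0 - α • N)
      (fromRows (0 : Matrix (Fin m) q ℝ) B) (fromRows (0 : Matrix (Fin m) q ℝ) B)ᴴ 1 := by
    rw [conjTranspose_eq_transpose_of_trivial, transpose_fromRows, transpose_zero, lmiMatrix,
      fromBlocks_smul, sub_eq_add_neg, fromBlocks_neg, fromBlocks_add]
    simp [sub_eq_add_neg]
  have h2 : fromRows (0 : Matrix (Fin m) q ℝ) B * (fromRows (0 : Matrix (Fin m) q ℝ) B)ᴴ =
      fromBlocks 0 0 0 (B * Bᵀ) := by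
    rw [conjTranspose_eq_transpose_of_trivial, transpose_fromRows, fromRows_mul_fromCols]
    simp
  have : Invertible (1 : Matrix q q ℝ) := invertibleOne
  rw [h1, PosDef.fromBlocks₂₂ _ _ PosDef.one, inv_one, Matrix.mul_one, h2]
  have h3 : fromBlocks A 0 0 0 - α • N - fromBlocks 0 0 0 (B * Bᵀ) =
      fromBlocks A 0 0 (-(B * Bᵀ)) - α • N := by
    rw [sub_right_comm, sub_eq_add_neg (fromBlocks A 0 0 0), fromBlocks_neg, fromBlocks_add]
    simp
  rw [h3]

theorem mem_qmiSet_fromBlocks_iff {m k : ℕ} {q : Type*} [Fintype q]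
    {A : Matrix (Fin m) (Fin m) ℝ} (B : Matrix (Fin k) q ℝ) (θ : Matrix (Fin k) (Fin m) ℝ) :
    θ ∈ qmiSet (fromBlocks A 0 0 (-(B * Bᵀ))) ↔ (A - θᵀ * B * (θᵀ * B)ᵀ).PosSemidef := by
  have h : (fromRows (1 : Matrix (Fin m) (Fin m) ℝ) θ)ᵀ * fromBlocks A 0 0 (-(B * Bᵀ)) *
      fromRows (1 : Matrix (Fin m) (Fin m) ℝ) θ = A - θᵀ * B * (θᵀ * B)ᵀ := by
    rw [transpose_fromRows, fromCols_mul_fromBlocks, fromCols_mul_fromRows]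
    simp [sub_eq_add_neg, Matrix.mul_assoc]
  rw [qmiSet, Set.mem_ofPred_eq, h]

/-- The robust bound `(θᵀ B)(θᵀ B)ᵀ ≤ A` over all parameters compatible with the data is
equivalent to a linear matrix inequality. -/
theorem forall_mem_qmiSet_iff_lmi {m k T : ℕ} {q : Type*} [Fintype q] [DecidableEq q]
    {Pi : Matrix (Fin m ⊕ Fin T) (Fin m ⊕ Fin T) ℝ} (hPi : IsNoiseModel Pi)
    {Y : Matrix (Fin m) (Fin T) ℝ} {Phi : Matrix (Fin k) (Fin T) ℝ}
    (hne : (qmiSet (dataMatrix Pi Y Phi)).Nonempty)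
    (hpos : HasPosEigenvalue (dataMatrix Pi Y Phi))
    {A : Matrix (Fin m) (Fin m) ℝ} (hA : A.IsSymm) (B : Matrix (Fin k) q ℝ) :
    (∀ θ ∈ qmiSet (dataMatrix Pi Y Phi), (A - θᵀ * B * (θᵀ * B)ᵀ).PosSemidef) ↔
      ∃ α : ℝ, 0 ≤ α ∧ (lmiMatrix A B (dataMatrix Pi Y Phi) α).PosSemidef := by
  have hM : (fromBlocks A 0 0 (-(B * Bᵀ))).IsSymm :=
    hA.fromBlocks (transpose_zero) (by simp [IsSymm])
  simp only [lmiMatrix_posSemidef_iff, ← mem_qmiSet_fromBlocks_iff]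
  exact qmiSet_subset_qmiSet_iff hM (dataMatrix_isSymm hPi.isSymm Y Phi)
    (neg_dataMatrix_toBlocks₂₂_posSemidef hPi.neg_def Y Phi)
    (fun η hη => dataMatrix_mulVec_eq_zero hPi.neg_def Y Phi hη) hne hpos

/-! ### Norms -/

theorem weightedNorm_smul {p : ℕ} (R : Matrix (Fin p) (Fin p) ℝ) (c : ℝ) (x : Vec p) :
    weightedNorm R (c • x) = |c| * weightedNorm R x := by
  rw [weightedNorm, weightedNorm, WithLp.ofLp_smul, mulVec_smul, WithLp.toLp_smul, norm_smul,
    Real.norm_eq_abs]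

theorem norm_toLp_sq {p : ℕ} (x : Fin p → ℝ) : ‖(WithLp.toLp 2 x : Vec p)‖ ^ 2 = x ⬝ᵥ x := by
  rw [EuclideanSpace.real_norm_sq_eq]
  simp [dotProduct, sq]

open scoped MatrixOrder in
theorem weightedNorm_matSqrt_sq {p : ℕ} {P : Matrix (Fin p) (Fin p) ℝ} (hP : P.PosSemidef)
    (x : Vec p) : weightedNorm (matSqrt P) x ^ 2 = x.ofLp ⬝ᵥ P *ᵥ x.ofLp := by
  have hsymm : (matSqrt P)ᵀ = matSqrt P := by
    have := (CFC.sqrt_nonneg P).posSemidef.isHermitian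
    rwa [IsHermitian, conjTranspose_eq_transpose_of_trivial] at this
  have hsq : matSqrt P * matSqrt P = P := CFC.sqrt_mul_sqrt_self P hP.nonneg
  rw [weightedNorm, norm_toLp_sq]
  have h := quadForm_transpose_mul_mul 1 (matSqrt P) x.ofLp
  rw [Matrix.mul_one, hsymm, hsq, one_mulVec] at h
  exact h.symm

theorem weightedNorm_matSqrt_pos {p : ℕ} {P : Matrix (Fin p) (Fin p) ℝ} (hP : P.PosDef)
    {x : Vec p} (hx : x ≠ 0) : 0 < weightedNorm (matSqrt P) x := by
  have h1 := weightedNorm_matSqrt_sq hP.posSemidef x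
  have h2 := hP.dotProduct_mulVec_pos (x := x.ofLp) (by simpa using hx)
  rw [star_trivial, ← h1] at h2
  exact lt_of_le_of_ne (norm_nonneg _) fun h => by simp [← h] at h2

/-- The weighted norm bound as the matrix inequality `v vᵀ ≤ L² P⁻¹`. -/
theorem weightedNorm_le_iff_posSemidef {p : ℕ} {P : Matrix (Fin p) (Fin p) ℝ} (hP : P.PosDef)
    {L : ℝ} (hL : 0 ≤ L) (v : Vec p) :
    weightedNorm (matSqrt P) v ≤ L ↔
      (L ^ 2 • P⁻¹ - replicateCol Unit v.ofLp * (replicateCol Unit v.ofLp)ᵀ).PosSemidef := by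
  have hPs := hP.posSemidef
  have hinv : P⁻¹.PosSemidef := hP.inv.posSemidef
  have hcancel : P⁻¹ *ᵥ (P *ᵥ v.ofLp) = v.ofLp := by
    rw [mulVec_mulVec, nonsing_inv_mul _ ((isUnit_iff_isUnit_det _).1 hP.isUnit), one_mulVec]
  have hPv : (P *ᵥ v.ofLp) ⬝ᵥ P⁻¹ *ᵥ (P *ᵥ v.ofLp) = v.ofLp ⬝ᵥ P *ᵥ v.ofLp := by
    rw [hcancel, dotProduct_comm]
  have h0 := (posSemidef_iff_isSymm_quadForm.1 hPs).2 v.ofLp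
  have hform : ∀ x : Fin p → ℝ,
      x ⬝ᵥ (L ^ 2 • P⁻¹ - replicateCol Unit v.ofLp * (replicateCol Unit v.ofLp)ᵀ) *ᵥ x =
        L ^ 2 * (x ⬝ᵥ P⁻¹ *ᵥ x) - (x ⬝ᵥ v.ofLp) ^ 2 := by
    intro x
    rw [transpose_replicateCol, ← vecMulVec_eq, sub_mulVec, smul_mulVec, dotProduct_sub,
      dotProduct_smul, smul_eq_mul, vecMulVec_mulVec, dotProduct_smul, dotProduct_comm v.ofLp x]
    simp [sq]
  have hsymm : (L ^ 2 • P⁻¹ - replicateCol Unit v.ofLp * (replicateCol Unit v.ofLp)ᵀ).IsSymm :=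
    ((posSemidef_iff_isSymm_quadForm.1 hinv).1.smul _).sub (by simp [IsSymm])
  have hw : 0 ≤ weightedNorm (matSqrt P) v := norm_nonneg _
  rw [← sq_le_sq₀ hw hL, weightedNorm_matSqrt_sq hPs, posSemidef_iff_isSymm_quadForm,
    and_iff_right hsymm]
  simp only [hform, sub_nonneg]
  constructor
  · intro h x
    have hcs := dotProduct_mulVec_sq_le hinv x (P *ᵥ v.ofLp)
    rw [hPv, hcancel] at hcs
    have := mul_le_mul_of_nonneg_left h ((posSemidef_iff_isSymm_quadForm.1 hinv).2 x)
    linarith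
  · intro h
    have h1 := h (P *ᵥ v.ofLp)
    rw [hPv, dotProduct_comm (P *ᵥ v.ofLp)] at h1
    rcases h0.eq_or_lt with hz | hp
    · rw [← hz]
      positivity
    · rw [sq (v.ofLp ⬝ᵥ P *ᵥ v.ofLp)] at h1
      exact le_of_mul_le_mul_right h1 hp

open scoped Matrix.Norms.L2Operator in
/-- The induced norm bound as the matrix inequality `G Gᵀ ≤ L² I`. -/
theorem inducedNorm_le_iff_posSemidef {p q : ℕ} {L : ℝ} (hL : 0 ≤ L)
    (G : Matrix (Fin p) (Fin q) ℝ) :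
    inducedNorm G ≤ L ↔ (L ^ 2 • (1 : Matrix (Fin p) (Fin p) ℝ) - G * Gᵀ).PosSemidef := by
  have hform : ∀ x : Vec p, x.ofLp ⬝ᵥ (L ^ 2 • (1 : Matrix (Fin p) (Fin p) ℝ) - G * Gᵀ) *ᵥ x.ofLp =
      (L * ‖x‖) ^ 2 - ‖(WithLp.toLp 2 (Gᵀ *ᵥ x.ofLp) : Vec q)‖ ^ 2 := by
    intro x
    have h1 := quadForm_transpose_mul_mul 1 Gᵀ x.ofLp
    rw [Matrix.mul_one, transpose_transpose, one_mulVec] at h1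
    rw [sub_mulVec, smul_mulVec, one_mulVec, dotProduct_sub, dotProduct_smul, smul_eq_mul, h1,
      norm_toLp_sq, mul_pow, ← norm_toLp_sq x.ofLp]
  have hsymm : (L ^ 2 • (1 : Matrix (Fin p) (Fin p) ℝ) - G * Gᵀ).IsSymm :=
    (isSymm_one.smul _).sub (by simp [IsSymm])
  rw [inducedNorm, ← l2_opNorm_conjTranspose, conjTranspose_eq_transpose_of_trivial, l2_opNorm_def,
    ContinuousLinearMap.opNorm_le_iff hL, posSemidef_iff_isSymm_quadForm, and_iff_right hsymm]
  constructor
  · intro h x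
    rw [← WithLp.ofLp_toLp 2 x, hform, sub_nonneg]
    exact pow_le_pow_left₀ (norm_nonneg _) (h _) 2
  · intro h x
    have h1 := h x.ofLp
    rw [hform, sub_nonneg] at h1
    exact le_of_sq_le_sq h1 (by positivity)

/-! ### The parametrized functions -/

theorem paramFun_sub {n k m : ℕ} (φ : Fin k → Vec n → ℝ) (θ : Matrix (Fin k) (Fin m) ℝ)
    (z z' : Vec n) : paramFun φ θ z - paramFun φ θ z' =
      WithLp.toLp 2 (θᵀ *ᵥ (basisVec φ z - basisVec φ z').ofLp) := by
  rw [paramFun, paramFun, WithLp.ofLp_sub, mulVec_sub, WithLp.toLp_sub]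

theorem mem_qmiSet_dataMatrix_of_measurement {n m k T : ℕ} {φ : Fin k → Vec n → ℝ}
    {zs : Fin T → Vec n} {θ : Matrix (Fin k) (Fin m) ℝ} {w y : Fin T → Vec m}
    (hy : ∀ t, y t = paramFun φ θ (zs t) + w t)
    {Pi : Matrix (Fin m ⊕ Fin T) (Fin m ⊕ Fin T) ℝ} (hw : (colMatrix w)ᵀ ∈ qmiSet Pi) :
    θ ∈ qmiSet (dataMatrix Pi (colMatrix y) (colMatrix fun t => basisVec φ (zs t))) := by
  rw [mem_qmiSet_dataMatrix_iff]
  convert hw using 2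
  ext i t
  simp [colMatrix, hy, paramFun, mulVec, dotProduct, mul_apply]

theorem jacobian_paramFun {n k m : ℕ} {φ : Fin k → Vec n → ℝ} (hφ : ∀ i, Differentiable ℝ (φ i))
    (θ : Matrix (Fin k) (Fin m) ℝ) (z : Vec n) :
    jacobian (paramFun φ θ) z = θᵀ * jacobian (basisVec φ) z := by
  have hb : DifferentiableAt ℝ (basisVec φ) z :=
    differentiableAt_piLp 2 |>.2 fun i => hφ i z
  let A : Vec k →L[ℝ] Vec m := LinearMap.toContinuousLinearMap (toEuclideanLin θᵀ)
  have hcomp : paramFun φ θ = A ∘ basisVec φ := rfl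
  have hd : fderiv ℝ (paramFun φ θ) z = A.comp (fderiv ℝ (basisVec φ) z) := by
    rw [hcomp]
    exact (A.hasFDerivAt.comp z hb.hasFDerivAt).fderiv
  ext i j
  rw [jacobian, of_apply, hd]
  simp [A, jacobian, mul_apply, toLpLin_apply, mulVec, dotProduct]

end SetValuedRegression

theorem mainTheorem3 {n m k T : ℕ}
    -- basis functions, sample points, true parameter, noise samples and measurements
    (φ : Fin k → SetValuedRegression.Vec n → ℝ)
    (zs : Fin T → SetValuedRegression.Vec n)
    (θhat : Matrix (Fin k) (Fin m) ℝ)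
    (w y : Fin T → SetValuedRegression.Vec m)
    (hy : ∀ t, y t = SetValuedRegression.paramFun φ θhat (zs t) + w t)
    -- the noise model
    (Pi : Matrix (Fin m ⊕ Fin T) (Fin m ⊕ Fin T) ℝ)
    (hPi : SetValuedRegression.IsNoiseModel Pi)
    (hw : (SetValuedRegression.colMatrix w).transpose ∈ SetValuedRegression.qmiSet Pi)
    -- the data matrix
    (N : Matrix (Fin m ⊕ Fin k) (Fin m ⊕ Fin k) ℝ)
    (hN : N = SetValuedRegression.dataMatrix Pi (SetValuedRegression.colMatrix y)
      (SetValuedRegression.colMatrix fun t => SetValuedRegression.basisVec φ (zs t)))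
    (hNpos : SetValuedRegression.HasPosEigenvalue N)
    (P : Matrix (Fin m) (Fin m) ℝ) (hP : P.PosDef)
    (Q : Matrix (Fin n) (Fin n) ℝ) (hQ : Q.PosDef)
    (L : ℝ) (hL : 0 ≤ L) :
    (∀ z z' : SetValuedRegression.Vec n, z ≠ z' →
      ((∀ θ ∈ SetValuedRegression.qmiSet N,
          SetValuedRegression.weightedNorm (SetValuedRegression.matSqrt P)
            (SetValuedRegression.paramFun φ θ z - SetValuedRegression.paramFun φ θ z') ≤
          L * SetValuedRegression.weightedNorm (SetValuedRegression.matSqrt Q) (z - z')) ↔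
        ∃ α : ℝ, 0 ≤ α ∧
          (SetValuedRegression.lmiMatrix (L ^ 2 • P⁻¹)
            (Matrix.replicateCol Unit
              ((SetValuedRegression.weightedNorm (SetValuedRegression.matSqrt Q) (z - z'))⁻¹ •
                (SetValuedRegression.basisVec φ z - SetValuedRegression.basisVec φ z')).ofLp)
            N α).PosSemidef)) ∧
    ((∀ i, Differentiable ℝ (φ i)) →
      ∀ z : SetValuedRegression.Vec n,
        ((∀ θ ∈ SetValuedRegression.qmiSet N,
            SetValuedRegression.inducedNorm
              (SetValuedRegression.jacobian (SetValuedRegression.paramFun φ θ) z) ≤ L) ↔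
          ∃ α : ℝ, 0 ≤ α ∧
            (SetValuedRegression.lmiMatrix (L ^ 2 • (1 : Matrix (Fin m) (Fin m) ℝ))
              (SetValuedRegression.jacobian (SetValuedRegression.basisVec φ) z)
              N α).PosSemidef)) := by
  subst hN
  have hne : (SetValuedRegression.qmiSet (SetValuedRegression.dataMatrix Pi
      (SetValuedRegression.colMatrix y)
      (SetValuedRegression.colMatrix fun t => SetValuedRegression.basisVec φ (zs t)))).Nonempty :=
    ⟨θhat, SetValuedRegression.mem_qmiSet_dataMatrix_of_measurement hy hw⟩
  refine ⟨fun z z' hz => ?_, fun hφ z => ?_⟩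
  · have hsymm : (L ^ 2 • P⁻¹).IsSymm :=
      (SetValuedRegression.posSemidef_iff_isSymm_quadForm.1 hP.inv.posSemidef).1.smul _
    rw [← SetValuedRegression.forall_mem_qmiSet_iff_lmi hPi hne hNpos hsymm]
    refine forall₂_congr fun θ _ => ?_
    have hpos := SetValuedRegression.weightedNorm_matSqrt_pos hQ (sub_ne_zero.2 hz)
    set r := SetValuedRegression.weightedNorm (SetValuedRegression.matSqrt Q) (z - z')
    have hv : θ.transpose * Matrix.replicateCol Unit
        (r⁻¹ • (SetValuedRegression.basisVec φ z - SetValuedRegression.basisVec φ z')).ofLp =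
        Matrix.replicateCol Unit (r⁻¹ • (SetValuedRegression.paramFun φ θ z -
          SetValuedRegression.paramFun φ θ z')).ofLp := by
      rw [← Matrix.replicateCol_mulVec, SetValuedRegression.paramFun_sub, WithLp.ofLp_smul,
        WithLp.ofLp_smul, Matrix.mulVec_smul]
    rw [hv, ← SetValuedRegression.weightedNorm_le_iff_posSemidef hP hL,
      SetValuedRegression.weightedNorm_smul, abs_of_pos (inv_pos.2 hpos), inv_mul_le_iff₀ hpos,
      mul_comm]
  · rw [← SetValuedRegression.forall_mem_qmiSet_iff_lmi hPi hne hNpos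
      (Matrix.isSymm_one.smul (L ^ 2))]
    refine forall₂_congr fun θ _ => ?_
    rw [SetValuedRegression.jacobian_paramFun hφ,
      SetValuedRegression.inducedNorm_le_iff_posSemidef hL]
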